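/- Conventions. Let $\mathcal C$ be a category with finite limits. A point over an object $A$ of $\mathcal C$ is a triple $(C,c,s_c)$ with $c\colon C\to A$, $s_c\colon A\to C$ and $c\,s_c=1_A$. The points over $A$ form a category $\mathrm{Pt}_A(\mathcal C)$, whose morphisms are the morphisms between domains that commute with the projections and with the sections. A cartesian morphism $(\gamma,q)\colon(C,c,s_c)\to(D,d,s_d)$ from a point over $A$ to a point over $Q$ is a pair $\gamma\colon C\to D$, $q\colon A\to Q$ such that $\gamma s_c=s_d q$ and the square $d\gamma=qc$ is a pullback. For $g\colon E\to A$, the change of base functor $g^*\colon\mathrm{Pt}_A(\mathcal C)\to\mathrm{Pt}_E(\mathcal C)$ is given by pullback along $g$. A monomorphism is normal if it is an equivalence class of some internal equivalence relation on its codomain. The category $\mathcal C$ is semi-abelian if it is pointed (it has a zero object), regular (finitely complete, with coequalizers of kernel pairs and pullback-stable regular epimorphisms), Barr exact (every internal equivalence relation is a kernel pair), protomodular (for every $A$ the kernel functor $\mathrm{Pt}_A(\mathcal C)\to\mathcal C$, $(C,c,s_c)\mapsto\mathrm{Ker}(c)$, reflects isomorphisms), and has finite coproducts. It is strongly semi-abelian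 if moreover every change of base functor $g^*$ is left exact, reflects isomorphisms and reflects normal monomorphisms. Proposition. Let $\mathcal C$ be a strongly semi-abelian category, let $(C,c,s_c)$ be a point over $A$, and let $q\colon A\to Q$ be a regular epimorphism. Let $k\colon K\to A$ be a kernel of $q$ and $k_c\colon Y\to C$ a kernel of $c$. The following are equivalent: 1. the pullback of $(C,c,s_c)$ along $k$ is (isomorphic in $\mathrm{Pt}_K(\mathcal C)$ to) the point $(Y\times K,\ \pi_2,\ \langle 0,1\rangle)$ over $K$; 2. there exist a point $(D,d,s_d)$ over $Q$ and a cartesian morphism $(\gamma,q)\colon(C,c,s_c)\to(D,d,s_d)$. -/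

import Mathlib

open CategoryTheory CategoryTheory.Limits

universe v u

namespace StrongSemiAb

/-- A point over `A` (an object of the fibre `Pt_A(C)`): a split epimorphism with codomain `A`
together with a chosen section. -/
structure Pt {C : Type u} [Category.{v} C] (A : C) where
  obj : C
  proj : obj ⟶ A
  sec : A ⟶ obj
  sec_proj : sec ≫ proj = 𝟙 A

/-- A morphism in the fibre `Pt_A(C)`: it commutes with the projections and with the sections. -/
@[ext]
structure Pt.Hom {C : Type u} [Category.{v} C] {A : C} (X Y : Pt A) where
  hom : X.obj ⟶ Y.obj
  hom_proj : hom ≫ Y.proj = X.proj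
  sec_hom : X.sec ≫ hom = Y.sec

/-- The fibre `Pt_A(C)` of the fibration of points over `A`. -/
instance Pt.category {C : Type u} [Category.{v} C] (A : C) : Category.{v} (Pt A) where
  Hom X Y := Pt.Hom X Y
  id X := ⟨𝟙 X.obj, Category.id_comp _, Category.comp_id _⟩
  comp f g := ⟨f.hom ≫ g.hom, by rw [Category.assoc, g.hom_proj, f.hom_proj],
    by rw [← Category.assoc, f.sec_hom, g.sec_hom]⟩
  id_comp f := Pt.Hom.ext (Category.id_comp _)
  comp_id f := Pt.Hom.ext (Category.comp_id _)
  assoc f g h := Pt.Hom.ext (Category.assoc _ _ _)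

/-- The functor sending a point over `A` to its domain. -/
def Pt.domain {C : Type u} [Category.{v} C] (A : C) : Pt A ⥤ C where
  obj X := X.obj
  map f := f.hom
  map_id _ := rfl
  map_comp _ _ := rfl

/-- `(f, g)` is a morphism of points from `X` (over `A`) to `Y` (over `B`) and is cartesian for
the fibration of points: the square of sections commutes, and the square of projections is a
pullback. -/
structure Pt.IsCartesian {C : Type u} [Category.{v} C] {A B : C} (X : Pt A) (Y : Pt B)
    (f : X.obj ⟶ Y.obj) (g : A ⟶ B) : Prop where
  sec_comm : X.sec ≫ f = g ≫ Y.sec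
  isPullback : IsPullback f X.proj Y.proj g

/-- The pullback of the point `X` over `A` along `g : E ⟶ A`. -/
noncomputable def Pt.pull {C : Type u} [Category.{v} C] [HasPullbacks C] {E A : C}
    (g : E ⟶ A) (X : Pt A) : Pt E where
  obj := pullback X.proj g
  proj := pullback.snd X.proj g
  sec := pullback.lift (g ≫ X.sec) (𝟙 E)
    (by rw [Category.assoc, X.sec_proj, Category.comp_id, Category.id_comp])
  sec_proj := pullback.lift_snd _ _ _

/-- The canonical morphism from the pullback of a point to the point itself. -/
noncomputable def Pt.pullFst {C : Type u} [Category.{v} C] [HasPullbacks C] {E A : C}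
    (g : E ⟶ A) (X : Pt A) : (X.pull g).obj ⟶ X.obj :=
  pullback.fst X.proj g

theorem Pt.pull_isCartesian {C : Type u} [Category.{v} C] [HasPullbacks C] {E A : C}
    (g : E ⟶ A) (X : Pt A) : (X.pull g).IsCartesian X (X.pullFst g) g where
  sec_comm := pullback.lift_fst _ _ _
  isPullback := IsPullback.of_hasPullback X.proj g

/-- The action of change of base on morphisms, induced by the universal property. -/
noncomputable def Pt.Hom.pull {C : Type u} [Category.{v} C] [HasPullbacks C] {E A : C}
    (g : E ⟶ A) {X Y : Pt A} (f : Pt.Hom X Y) : Pt.Hom (X.pull g) (Y.pull g) where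
  hom := (Y.pull_isCartesian g).isPullback.lift (X.pullFst g ≫ f.hom) (X.pull g).proj
    (by rw [Category.assoc, f.hom_proj, (X.pull_isCartesian g).isPullback.w])
  hom_proj := IsPullback.lift_snd _ _ _ _
  sec_hom := by
    apply (Y.pull_isCartesian g).isPullback.hom_ext
    · rw [Category.assoc, IsPullback.lift_fst, ← Category.assoc, (X.pull_isCartesian g).sec_comm,
        (Y.pull_isCartesian g).sec_comm, Category.assoc, f.sec_hom]
    · rw [Category.assoc, IsPullback.lift_snd, Pt.sec_proj, Pt.sec_proj]

theorem Pt.Hom.pull_hom_fst {C : Type u} [Category.{v} C] [HasPullbacks C] {E A : C}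
    (g : E ⟶ A) {X Y : Pt A} (f : Pt.Hom X Y) :
    (f.pull g).hom ≫ Y.pullFst g = X.pullFst g ≫ f.hom :=
  IsPullback.lift_fst _ _ _ _

theorem Pt.Hom.pull_ext {C : Type u} [Category.{v} C] [HasPullbacks C] {E A : C}
    (g : E ⟶ A) {X : Pt E} {Y : Pt A} {f f' : Pt.Hom X (Y.pull g)}
    (h : f.hom ≫ Y.pullFst g = f'.hom ≫ Y.pullFst g) : f = f' :=
  Pt.Hom.ext ((Y.pull_isCartesian g).isPullback.hom_ext h (f.hom_proj.trans f'.hom_proj.symm))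

/-- The change of base functor `g^* : Pt_A(C) ⥤ Pt_E(C)` along `g : E ⟶ A`, by pullback. -/
noncomputable def changeOfBase {C : Type u} [Category.{v} C] [HasPullbacks C] {E A : C}
    (g : E ⟶ A) : Pt A ⥤ Pt E where
  obj X := X.pull g
  map f := Pt.Hom.pull g f
  map_id X := by
    apply Pt.Hom.pull_ext
    exact (Pt.Hom.pull_hom_fst g (𝟙 X : X ⟶ X)).trans
      ((Category.comp_id _).trans (Category.id_comp _).symm)
  map_comp {X Y Z} f h := by
    apply Pt.Hom.pull_ext
    change (Pt.Hom.pull g (f ≫ h)).hom ≫ _ =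
      ((Pt.Hom.pull g f).hom ≫ (Pt.Hom.pull g h).hom) ≫ _
    rw [Category.assoc, Pt.Hom.pull_hom_fst, Pt.Hom.pull_hom_fst, ← Category.assoc,
      Pt.Hom.pull_hom_fst, Category.assoc]
    rfl

/-- The kernel functor `K_A : Pt_A(C) ⥤ C`: change of base along the initial arrow `0 ⟶ A`,
followed by the identification of `Pt_0(C)` with `C`. -/
noncomputable def kernelFunctor {C : Type u} [Category.{v} C] [HasPullbacks C] [HasZeroObject C]
    [HasZeroMorphisms C] (A : C) : Pt A ⥤ C :=
  open scoped ZeroObject in changeOfBase (0 : (0 : C) ⟶ A) ⋙ Pt.domain (0 : C)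

/-- The point `(Y × K, π₂, ⟨0, 1⟩)` over `K`. -/
noncomputable def productPt {C : Type u} [Category.{v} C] [HasBinaryProducts C]
    [HasZeroMorphisms C] (Y K : C) : Pt K where
  obj := Y ⨯ K
  proj := prod.snd
  sec := prod.lift 0 (𝟙 K)
  sec_proj := prod.lift_snd _ _

/-- A monomorphism is normal when it is an equivalence class of some internal equivalence
relation `(R, r₁, r₂)` on its codomain. In terms of generalized elements: any two elements
of `X` are related by `R`, and every element related to an element of `X` belongs to `X`.
Equivalently, `f × f` lifts to `X × X ⟶ R`, and the resulting morphism of equivalence relations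
is a discrete fibration. -/
def IsNormalMonomorphism {D : Type u} [Category.{v} D] {X Y : D} (f : X ⟶ Y) : Prop :=
  Mono f ∧ ∃ (R : D) (r₁ r₂ : R ⟶ Y), IsEquivalenceRelation r₁ r₂ ∧
    (∀ ⦃T : D⦄ (x x' : T ⟶ X), ∃ t : T ⟶ R, t ≫ r₁ = x ≫ f ∧ t ≫ r₂ = x' ≫ f) ∧
    (∀ ⦃T : D⦄ (x : T ⟶ X) (t : T ⟶ R), t ≫ r₁ = x ≫ f → ∃ x' : T ⟶ X, x' ≫ f = t ≫ r₂)

/-- A normal functor: left exact, conservative, and reflecting normal monomorphisms. -/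
structure IsNormalFunctor {D : Type*} [Category* D] {E : Type*} [Category* E]
    (F : D ⥤ E) : Prop where
  leftExact : PreservesFiniteLimits F
  conservative : F.ReflectsIsomorphisms
  reflects_normal : ∀ ⦃X Y : D⦄ (f : X ⟶ Y),
    IsNormalMonomorphism (F.map f) → IsNormalMonomorphism f

/-- A semi-abelian category: pointed, regular (finitely complete, with coequalizers of kernel pairs
and pullback-stable regular epimorphisms), Barr exact (equivalence relations are kernel pairs),
protomodular (kernel functors reflect isomorphisms), with finite coproducts. -/
class SemiAbelian (C : Type u) [Category.{v} C] [HasZeroMorphisms C] : Prop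
    extends Regular C, HasZeroObject C where
  hasFiniteCoproducts : HasFiniteCoproducts C
  exact : ∀ ⦃R X : C⦄ (r₁ r₂ : R ⟶ X), IsEquivalenceRelation r₁ r₂ →
    ∃ (Z : C) (f : X ⟶ Z), IsKernelPair f r₁ r₂
  protomodular : ∀ A : C, (kernelFunctor A).ReflectsIsomorphisms

/-- A strongly semi-abelian category: a semi-abelian category that is strongly protomodular, i.e.
all of whose change of base functors between fibres of points are normal functors. -/
class StronglySemiAbelian (C : Type u) [Category.{v} C] [HasZeroMorphisms C] : Prop
    extends SemiAbelian C where
  changeOfBase_normal : ∀ ⦃E A : C⦄ (g : E ⟶ A), IsNormalFunctor (changeOfBase g)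

end StrongSemiAb

open StrongSemiAb

/-! Write `p`, `s` for the projection and section of `P`. Descent along `q` amounts to a transport
`ρ(x, a)`, moving `x` into the fibre over `a` whenever `q (p x) = q a`, with `ρ(x, p x) = x` and
`ρ(s a, a') = s a'`. The quotient of `P.obj` by `x ~ ρ(x, a)` is then the descended point.

To build `ρ`, embed the kernel pair of `q` in the orbit `{(x, a)}` by `(a, a') ↦ (s a, a')`, over
`A` via the second coordinate. On kernels over `A` this is the section of `P.pull k`; if that point
is `Y × K`, it is a kernel of the projection to `Y`, hence normal. Strong protomodularity makes the
embedding itself normal (`Pt.isNormalMonomorphism_orbitSec`). Dividing the orbit by the resulting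
relation identifies it with a copy of `P`, and the quotient map is `ρ` (`Pt.exists_transport`).
Protomodularity makes `~` an equivalence relation, exactness gives its quotient, and a regular
epimorphism argument gives the pullback square (`Pt.exists_isCartesian_of_transport`).

The converse needs only limits: over `K` the composite to `Q` is zero, so each fibre is identified
with `Y` through `γ`. -/

namespace StrongSemiAb

/-! ### Limits, free points and equivalence relations in the fibres -/

section Points

variable {C : Type u} [Category.{v} C]

@[simp]
theorem Pt.comp_hom {A : C} {X Y Z : Pt A} (f : X ⟶ Y) (g : Y ⟶ Z) :
    Pt.Hom.hom (f ≫ g) = Pt.Hom.hom f ≫ Pt.Hom.hom g := rfl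

attribute [simp] Pt.sec_proj Pt.Hom.hom_proj Pt.Hom.sec_hom

@[simp]
theorem Pt.sec_proj_assoc {A : C} (X : Pt A) {Z : C} (h : A ⟶ Z) :
    X.sec ≫ X.proj ≫ h = h := by
  rw [← Category.assoc, X.sec_proj, Category.id_comp]

@[simp]
theorem Pt.Hom.sec_hom_assoc {A : C} {X Y : Pt A} (f : X ⟶ Y) {Z : C} (h : Y.obj ⟶ Z) :
    X.sec ≫ Pt.Hom.hom f ≫ h = Y.sec ≫ h := by
  rw [← Category.assoc, Pt.Hom.sec_hom]

theorem Pt.hom_ext {A : C} {X Y : Pt A} {f g : X ⟶ Y} (h : Pt.Hom.hom f = Pt.Hom.hom g) : f = g :=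
  Pt.Hom.ext h

theorem Pt.mono_of_mono_hom {A : C} {X Y : Pt A} (f : X ⟶ Y) [Mono (Pt.Hom.hom f)] : Mono f where
  right_cancellation _ _ w := Pt.hom_ext
    ((cancel_mono (Pt.Hom.hom f)).1 (congrArg Pt.Hom.hom w))

/-- The fibre product of two morphisms of points. -/
noncomputable def Pt.fibreProd [HasPullbacks C] {A : C} {X Y Z : Pt A} (f : X ⟶ Z) (g : Y ⟶ Z) :
    Pt A where
  obj := pullback (Pt.Hom.hom f) (Pt.Hom.hom g)
  proj := pullback.fst _ _ ≫ X.proj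
  sec := pullback.lift X.sec Y.sec (by simp)
  sec_proj := by rw [pullback.lift_fst_assoc, X.sec_proj]

noncomputable def Pt.fibreProdFst [HasPullbacks C] {A : C} {X Y Z : Pt A}
    (f : X ⟶ Z) (g : Y ⟶ Z) : Pt.fibreProd f g ⟶ X where
  hom := pullback.fst _ _
  hom_proj := rfl
  sec_hom := pullback.lift_fst _ _ _

noncomputable def Pt.fibreProdSnd [HasPullbacks C] {A : C} {X Y Z : Pt A}
    (f : X ⟶ Z) (g : Y ⟶ Z) : Pt.fibreProd f g ⟶ Y where
  hom := pullback.snd _ _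
  hom_proj := by
    change _ = pullback.fst (Pt.Hom.hom f) (Pt.Hom.hom g) ≫ X.proj
    rw [← Pt.Hom.hom_proj g, ← Pt.Hom.hom_proj f, pullback.condition_assoc]; rfl
  sec_hom := pullback.lift_snd _ _ _

theorem Pt.fibreProd_condition [HasPullbacks C] {A : C} {X Y Z : Pt A} (f : X ⟶ Z) (g : Y ⟶ Z) :
    Pt.fibreProdFst f g ≫ f = Pt.fibreProdSnd f g ≫ g :=
  Pt.hom_ext pullback.condition

noncomputable def Pt.fibreProdLift [HasPullbacks C] {A : C} {X Y Z T : Pt A}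
    {f : X ⟶ Z} {g : Y ⟶ Z} (a : T ⟶ X) (b : T ⟶ Y) (w : a ≫ f = b ≫ g) :
    T ⟶ Pt.fibreProd f g where
  hom := pullback.lift (Pt.Hom.hom a) (Pt.Hom.hom b) (congrArg Pt.Hom.hom w)
  hom_proj := (pullback.lift_fst_assoc _ _ _ _).trans (Pt.Hom.hom_proj a)
  sec_hom := by
    apply pullback.hom_ext
    · simp [Pt.fibreProd, pullback.lift_fst]
    · simp [Pt.fibreProd, pullback.lift_snd]

/-- Pullbacks are computed on domains. They supply the kernel pair that witnesses normality in the
fibre over the zero object. -/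
instance Pt.hasPullbacks [HasPullbacks C] (A : C) : HasPullbacks (Pt A) :=
  have (X Y Z : Pt A) (f : X ⟶ Z) (g : Y ⟶ Z) : HasLimit (cospan f g) :=
    ⟨⟨⟨_, PullbackCone.IsLimit.mk (Pt.fibreProd_condition f g)
      (fun s => Pt.fibreProdLift s.fst s.snd s.condition)
      (fun _ => Pt.hom_ext (pullback.lift_fst _ _ _))
      (fun _ => Pt.hom_ext (pullback.lift_snd _ _ _))
      (fun _ _ h₁ h₂ => Pt.hom_ext (pullback.hom_ext
        ((congrArg Pt.Hom.hom h₁).trans (pullback.lift_fst _ _ _).symm)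
        ((congrArg Pt.Hom.hom h₂).trans (pullback.lift_snd _ _ _).symm)))⟩⟩⟩
  hasPullbacks_of_hasLimit_cospan _

/-- The point over `A` freely generated by a morphism `S ⟶ A`. -/
noncomputable def Pt.free [HasBinaryCoproducts C] {A S : C} (p : S ⟶ A) : Pt A where
  obj := S ⨿ A
  proj := coprod.desc p (𝟙 A)
  sec := coprod.inr
  sec_proj := coprod.inr_desc _ _

/-- The inclusion of generators in a free point. -/
noncomputable def Pt.freeInl [HasBinaryCoproducts C] {A S : C} (p : S ⟶ A) :
    S ⟶ (Pt.free p).obj := coprod.inl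

/-- Turns a generalized element of the domain into a morphism of points, so that conditions
quantified over points can be tested on arbitrary elements. -/
noncomputable def Pt.freeDesc [HasBinaryCoproducts C] {A S : C} {p : S ⟶ A} {X : Pt A}
    (t : S ⟶ X.obj) (h : t ≫ X.proj = p) : Pt.free p ⟶ X where
  hom := coprod.desc t X.sec
  hom_proj := by apply coprod.hom_ext <;> simp [Pt.free, h]
  sec_hom := coprod.inr_desc _ _

@[simp]
theorem Pt.freeInl_freeDesc [HasBinaryCoproducts C] {A S : C} {p : S ⟶ A} {X : Pt A}
    (t : S ⟶ X.obj) (h : t ≫ X.proj = p) : Pt.freeInl p ≫ Pt.Hom.hom (Pt.freeDesc t h) = t :=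
  coprod.inl_desc _ _

@[simp]
theorem Pt.freeInl_freeDesc_assoc [HasBinaryCoproducts C] {A S : C} {p : S ⟶ A} {X : Pt A}
    (t : S ⟶ X.obj) (h : t ≫ X.proj = p) {Z : C} (g : X.obj ⟶ Z) :
    Pt.freeInl p ≫ Pt.Hom.hom (Pt.freeDesc t h) ≫ g = t ≫ g := by
  rw [← Category.assoc, Pt.freeInl_freeDesc]

theorem Pt.freeHom_ext [HasBinaryCoproducts C] {A S : C} {p : S ⟶ A} {X : Pt A}
    {f g : Pt.free p ⟶ X}
    (h : Pt.freeInl p ≫ Pt.Hom.hom f = Pt.freeInl p ≫ Pt.Hom.hom g) : f = g :=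
  Pt.hom_ext (coprod.hom_ext h ((Pt.Hom.sec_hom f).trans (Pt.Hom.sec_hom g).symm))

/-- The underlying relation of an equivalence relation in the fibre `Pt_A(C)` is an
equivalence relation. -/
theorem Pt.isEquivalenceRelation_hom [HasPullbacks C] [HasBinaryCoproducts C] {A : C}
    {R X : Pt A} (r₁ r₂ : R ⟶ X) (h : IsEquivalenceRelation r₁ r₂) :
    IsEquivalenceRelation (Pt.Hom.hom r₁) (Pt.Hom.hom r₂) := by
  obtain ⟨⟨e⟩⟩ := h
  -- Transitivity of `e` uses an arbitrary pullback in `Pt A`; `l` compares it with the one computed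
  -- in `C`.
  obtain ⟨l, h₁, h₂⟩ := PullbackCone.IsLimit.lift' e.isLimit _ _ (Pt.fibreProd_condition r₂ r₁)
  refine ⟨⟨{
    right_cancellation := ?_, r := Pt.Hom.hom e.r, s := Pt.Hom.hom e.s,
    c := _, isLimit := pullback.isLimit (Pt.Hom.hom r₂) (Pt.Hom.hom r₁),
    t := Pt.Hom.hom (l ≫ e.t), reflexivity₁ := ?_, reflexivity₂ := ?_, symmetry₁ := ?_,
    symmetry₂ := ?_, transitivity₁ := ?_, transitivity₂ := ?_ }⟩⟩
  · intro S f g w₁ w₂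
    have hp : g ≫ R.proj = f ≫ R.proj := by
      rw [← Pt.Hom.hom_proj r₁, reassoc_of% w₁]
    have := e.right_cancellation (Pt.freeDesc f rfl) (Pt.freeDesc g hp)
      (Pt.freeHom_ext (by simpa using w₁)) (Pt.freeHom_ext (by simpa using w₂))
    simpa using congrArg (fun t => Pt.freeInl _ ≫ Pt.Hom.hom t) this
  · exact congrArg Pt.Hom.hom e.reflexivity₁
  · exact congrArg Pt.Hom.hom e.reflexivity₂
  · exact congrArg Pt.Hom.hom e.symmetry₁
  · exact congrArg Pt.Hom.hom e.symmetry₂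
  · exact congrArg Pt.Hom.hom (show (l ≫ e.t) ≫ r₁ = Pt.fibreProdFst r₂ r₁ ≫ r₁ by
      rw [Category.assoc, e.transitivity₁, reassoc_of% h₁])
  · exact congrArg Pt.Hom.hom (show (l ≫ e.t) ≫ r₂ = Pt.fibreProdSnd r₂ r₁ ≫ r₂ by
      rw [Category.assoc, e.transitivity₂, reassoc_of% h₂])

end Points

/-- A monomorphism which is a fibre of a morphism `g` is normal. -/
theorem isNormalMonomorphism_of_fibre {D : Type u} [Category.{v} D] [HasPullbacks D]
    {X Y Z : D} (f : X ⟶ Y) (hf : Mono f) (g : Y ⟶ Z)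
    (h₁ : ∀ ⦃T : D⦄ (x x' : T ⟶ X), x ≫ f ≫ g = x' ≫ f ≫ g)
    (h₂ : ∀ ⦃T : D⦄ (x : T ⟶ X) (t : T ⟶ Y), t ≫ g = x ≫ f ≫ g → ∃ x', x' ≫ f = t) :
    IsNormalMonomorphism f := by
  refine ⟨hf, pullback g g, pullback.fst g g, pullback.snd g g,
    ⟨⟨IsKernelPair.equivalenceRelation g _ _ (pullback.isLimit _ _)
      (IsKernelPair.of_hasPullback g)⟩⟩, fun T x x' => ?_, fun T x t w => ?_⟩
  · exact ⟨pullback.lift (x ≫ f) (x' ≫ f) (by simpa using h₁ x x'),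
      pullback.lift_fst _ _ _, pullback.lift_snd _ _ _⟩
  · exact h₂ x _ (by rw [Category.assoc, ← pullback.condition, reassoc_of% w])

/-! ### Consequences of protomodularity and exactness -/

section SemiAbelian

variable {C : Type u} [Category.{v} C] [HasZeroMorphisms C]

/-- A morphism of points inducing a bijection on generalized elements of the kernels is an
isomorphism. -/
theorem SemiAbelian.isIso_hom [SemiAbelian C] {A : C} {X Y : Pt A} (f : X ⟶ Y)
    (h : ∀ ⦃T : C⦄ (t : T ⟶ Y.obj), t ≫ Y.proj = 0 → ∃! x : T ⟶ X.obj, x ≫ Pt.Hom.hom f = t) :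
    IsIso (Pt.Hom.hom f) := by
  have := SemiAbelian.protomodular A
  have hX (X : Pt A) : X.pullFst (0 : (HasZeroObject.zero' C).zero ⟶ A) ≫ X.proj = 0 := by
    rw [(X.pull_isCartesian _).isPullback.w, comp_zero]
  have hk : IsIso ((kernelFunctor A).map f) := by
    obtain ⟨x, hx, -⟩ := h _ (hX Y)
    have hm : Pt.Hom.hom (Pt.Hom.pull 0 f) ≫ Y.pullFst (0 : (HasZeroObject.zero' C).zero ⟶ A)
      = X.pullFst 0 ≫ Pt.Hom.hom f := Pt.Hom.pull_hom_fst 0 f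
    have hx0 : x ≫ X.proj = 0 := by rw [← Pt.Hom.hom_proj f, reassoc_of% hx, hX]
    obtain ⟨j, hj, -⟩ := (X.pull_isCartesian
      (0 : (HasZeroObject.zero' C).zero ⟶ A)).isPullback.exists_lift x (Y.pull 0).proj (by rw [hx0, comp_zero])
    refine ⟨j, ?_, ?_⟩
    · apply (X.pull_isCartesian _).isPullback.hom_ext
      · obtain ⟨y, -, hy⟩ := h (X.pullFst (0 : (HasZeroObject.zero' C).zero ⟶ A) ≫ Pt.Hom.hom f)
          (by rw [Category.assoc, Pt.Hom.hom_proj, hX])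
        refine (hy _ ?_).trans (hy _ ?_).symm
        · rw [← hm, ← hx, ← hj]; simp [kernelFunctor, changeOfBase, Pt.domain]
        · exact congrArg (· ≫ Pt.Hom.hom f) (Category.id_comp (X.pullFst _))
      · exact HasZeroObject.to_zero_ext _ _
    · apply (Y.pull_isCartesian _).isPullback.hom_ext
      · change (j ≫ Pt.Hom.hom (Pt.Hom.pull 0 f)) ≫ _ = _
        rw [Category.assoc, hm, reassoc_of% hj, hx]
        exact (Category.id_comp (Y.pullFst _)).symm
      · exact HasZeroObject.to_zero_ext _ _
  have := isIso_of_reflects_iso f (kernelFunctor A)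
  exact (inferInstance : IsIso ((Pt.domain A).map f))

/-- A subobject of a split extension containing the section and the kernel is everything. -/
theorem SemiAbelian.isIso_of_mono [SemiAbelian C] {X B : C} {p : X ⟶ B} {s : B ⟶ X}
    (hsp : s ≫ p = 𝟙 B) {M : C} (m : M ⟶ X) [Mono m] (s' : B ⟶ M) (hs : s' ≫ m = s)
    (h : ∀ ⦃T : C⦄ (t : T ⟶ X), t ≫ p = 0 → ∃ x, x ≫ m = t) : IsIso m := by
  let Y : Pt B := ⟨M, m ≫ p, s', by rw [reassoc_of% hs, hsp]⟩
  let f : Y ⟶ ⟨X, p, s, hsp⟩ := ⟨m, rfl, hs⟩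
  refine SemiAbelian.isIso_hom f fun T t ht => ?_
  obtain ⟨x, hx⟩ := h t ht
  exact ⟨x, hx, fun y hy => (cancel_mono m).1 (hy.trans hx.symm)⟩

/-- The section and the kernel of a split epimorphism are jointly epic. -/
theorem SemiAbelian.hom_ext_of_split [SemiAbelian C] {X B : C} {p : X ⟶ B} {s : B ⟶ X}
    (hsp : s ≫ p = 𝟙 B) {Z : C} {f g : X ⟶ Z} (hs : s ≫ f = s ≫ g)
    (h : ∀ ⦃T : C⦄ (t : T ⟶ X), t ≫ p = 0 → t ≫ f = t ≫ g) : f = g := by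
  have := SemiAbelian.isIso_of_mono hsp (equalizer.ι f g) (equalizer.lift _ hs)
    (equalizer.lift_ι _ _) fun T t ht => ⟨equalizer.lift t (h t ht), equalizer.lift_ι _ _⟩
  exact (cancel_epi (equalizer.ι f g)).1 (equalizer.condition f g)

/-- A morphism with trivial kernel is a monomorphism. -/
theorem SemiAbelian.mono_of_kernel [SemiAbelian C] {X Y : C} (f : X ⟶ Y)
    (h : ∀ ⦃T : C⦄ (t : T ⟶ X), t ≫ f = 0 → t = 0) : Mono f := by
  -- The kernel pair is split by the diagonal, where its projections agree; the kernel of the first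
  -- projection consists of pairs `(0, y)` with `f y = 0`.
  refine (IsKernelPair.of_hasPullback f).mono_of_eq_fst_snd
    (SemiAbelian.hom_ext_of_split (pullback.lift_fst (𝟙 X) (𝟙 X) rfl)
      (by rw [pullback.lift_fst, pullback.lift_snd]) fun T t ht => ?_)
  rw [ht, h (t ≫ pullback.snd f f)]
  rw [Category.assoc, ← pullback.condition, reassoc_of% ht, zero_comp]

/-- In an exact category, equivalence relations are kernel pairs of regular epimorphisms. -/
theorem SemiAbelian.exists_quotient [SemiAbelian C] {R X : C} (r₁ r₂ : R ⟶ X)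
    (h : IsEquivalenceRelation r₁ r₂) :
    ∃ (V : C) (π : X ⟶ V), IsRegularEpi π ∧ IsKernelPair π r₁ r₂ := by
  obtain ⟨Z, f, hf⟩ := SemiAbelian.exact r₁ r₂ h
  let F := Regular.strongEpiMonoFactorisation f
  refine ⟨F.I, F.e, inferInstanceAs (IsRegularEpi (Regular.strongEpiMonoFactorisation f).e), ?_⟩
  rw [← F.fac] at hf
  exact hf.cancel_right_of_mono

end SemiAbelian

/-! ### The orbit of a point and its split projection to the kernel pair -/

section Orbit

variable {C : Type u} [Category.{v} C] [HasPullbacks C] {A Q : C}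

/-- The point over `A` whose domain consists of the pairs `(x, a)` such that the projection of
`x` and `a` have the same image under `q`. -/
noncomputable def Pt.orbit (P : Pt A) (q : A ⟶ Q) : Pt A where
  obj := pullback (P.proj ≫ q) q
  proj := pullback.snd _ _
  sec := pullback.lift P.sec (𝟙 A) (by simp)
  sec_proj := pullback.lift_snd _ _ _

noncomputable def Pt.orbitFst (P : Pt A) (q : A ⟶ Q) : (P.orbit q).obj ⟶ P.obj :=
  pullback.fst _ _

theorem Pt.orbit_isPullback (P : Pt A) (q : A ⟶ Q) :
    IsPullback (P.orbitFst q) (P.orbit q).proj (P.proj ≫ q) q :=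
  IsPullback.of_hasPullback _ _

/-- The kernel pair of `q`, as a point over `A` split by the diagonal. -/
noncomputable def kernelPairPt (q : A ⟶ Q) : Pt A where
  obj := pullback q q
  proj := pullback.snd _ _
  sec := pullback.lift (𝟙 A) (𝟙 A) rfl
  sec_proj := pullback.lift_snd _ _ _

noncomputable def kernelPairFst (q : A ⟶ Q) : (kernelPairPt q).obj ⟶ A :=
  pullback.fst _ _

theorem kernelPairPt_isKernelPair (q : A ⟶ Q) :
    IsKernelPair q (kernelPairFst q) (kernelPairPt q).proj :=
  IsPullback.of_hasPullback _ _

theorem kernelPairPt_sec_fst (q : A ⟶ Q) : (kernelPairPt q).sec ≫ kernelPairFst q = 𝟙 A :=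
  pullback.lift_fst _ _ _

/-- The section of `P` acts as a morphism of points from the kernel pair of `q` to the orbit. -/
noncomputable def Pt.orbitSec (P : Pt A) (q : A ⟶ Q) : kernelPairPt q ⟶ P.orbit q where
  hom := (P.orbit_isPullback q).lift (kernelPairFst q ≫ P.sec) (kernelPairPt q).proj
    (by simp [(kernelPairPt_isKernelPair q).w])
  hom_proj := (P.orbit_isPullback q).lift_snd _ _ _
  sec_hom := by
    apply (P.orbit_isPullback q).hom_ext
    · rw [Category.assoc, IsPullback.lift_fst, ← Category.assoc, kernelPairPt_sec_fst,
        Category.id_comp]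
      exact (pullback.lift_fst _ _ _).symm
    · simp

theorem Pt.orbitSec_fst (P : Pt A) (q : A ⟶ Q) :
    Pt.Hom.hom (P.orbitSec q) ≫ P.orbitFst q = kernelPairFst q ≫ P.sec :=
  (P.orbit_isPullback q).lift_fst _ _ _

/-- The inclusion of `P` in its orbit, sending `x` to `(x, proj x)`. -/
noncomputable def Pt.toOrbit (P : Pt A) (q : A ⟶ Q) : P ⟶ P.orbit q where
  hom := (P.orbit_isPullback q).lift (𝟙 _) P.proj (by simp)
  hom_proj := (P.orbit_isPullback q).lift_snd _ _ _
  sec_hom := by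
    apply (P.orbit_isPullback q).hom_ext
    · rw [Category.assoc, IsPullback.lift_fst, Category.comp_id]
      exact (pullback.lift_fst _ _ _).symm
    · simp

theorem Pt.toOrbit_fst (P : Pt A) (q : A ⟶ Q) :
    Pt.Hom.hom (P.toOrbit q) ≫ P.orbitFst q = 𝟙 P.obj :=
  (P.orbit_isPullback q).lift_fst _ _ _

/-- The projection of the orbit of `P` to the kernel pair of `q`, split by `P.orbitSec q`. -/
noncomputable def Pt.orbitProj (P : Pt A) (q : A ⟶ Q) :
    (P.orbit q).obj ⟶ (kernelPairPt q).obj :=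
  (kernelPairPt_isKernelPair q).lift (P.orbitFst q ≫ P.proj) (P.orbit q).proj
    (by rw [Category.assoc]; exact (P.orbit_isPullback q).w)

theorem Pt.orbitProj_fst (P : Pt A) (q : A ⟶ Q) :
    P.orbitProj q ≫ kernelPairFst q = P.orbitFst q ≫ P.proj :=
  (kernelPairPt_isKernelPair q).lift_fst _ _ _

theorem Pt.orbitProj_snd (P : Pt A) (q : A ⟶ Q) :
    P.orbitProj q ≫ (kernelPairPt q).proj = (P.orbit q).proj :=
  (kernelPairPt_isKernelPair q).lift_snd _ _ _

theorem Pt.orbitSec_proj (P : Pt A) (q : A ⟶ Q) :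
    Pt.Hom.hom (P.orbitSec q) ≫ P.orbitProj q = 𝟙 _ := by
  apply (kernelPairPt_isKernelPair q).hom_ext
  · rw [Category.assoc, P.orbitProj_fst, ← Category.assoc, Pt.orbitSec_fst]; simp
  · rw [Category.assoc, P.orbitProj_snd]; simp

instance Pt.mono_orbitSec (P : Pt A) (q : A ⟶ Q) : Mono (Pt.Hom.hom (P.orbitSec q)) :=
  mono_of_mono_fac (P.orbitSec_proj q)

variable [HasZeroMorphisms C]

/-- The kernel of `(x, a) ↦ (p x, a)` consists of the `(x, 0)` with `p x = 0`. Hence identities on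
the orbit need checking only on `P.orbitSec q` and on such elements. -/
theorem Pt.orbitProj_kernel (P : Pt A) (q : A ⟶ Q) {T : C} (t : T ⟶ (P.orbit q).obj)
    (h : t ≫ P.orbitProj q = 0) :
    (t ≫ P.orbitFst q) ≫ P.proj = 0 ∧
      (t ≫ P.orbitFst q) ≫ Pt.Hom.hom (P.toOrbit q) = t := by
  have h₁ : t ≫ P.orbitFst q ≫ P.proj = 0 := by
    rw [← Pt.orbitProj_fst, reassoc_of% h, zero_comp]
  have h₂ : t ≫ (P.orbit q).proj = 0 := by
    rw [← Pt.orbitProj_snd, reassoc_of% h, zero_comp]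
  refine ⟨by rw [Category.assoc, h₁], (P.orbit_isPullback q).hom_ext ?_ ?_⟩
  · rw [Category.assoc, Pt.toOrbit_fst, Category.comp_id]
  · rw [Category.assoc, Pt.Hom.hom_proj, Category.assoc, h₁, h₂]

end Orbit

/-! ### From normality to transport, and from transport to descent -/

section Transport

variable {C : Type u} [Category.{v} C] [HasZeroMorphisms C] [SemiAbelian C] {A Q : C}

/-- If the kernel pair of `q` is normal in the orbit of `P`, the fibres of `P` can be transported
along the kernel pair. -/
theorem Pt.exists_transport (P : Pt A) (q : A ⟶ Q) (h : IsNormalMonomorphism (P.orbitSec q)) :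
    ∃ ρ : (P.orbit q).obj ⟶ P.obj, ρ ≫ P.proj = (P.orbit q).proj ∧
      Pt.Hom.hom (P.toOrbit q) ≫ ρ = 𝟙 _ ∧
      Pt.Hom.hom (P.orbitSec q) ≫ ρ = (kernelPairPt q).proj ≫ P.sec := by
  have := SemiAbelian.hasFiniteCoproducts (C := C)
  obtain ⟨_, T, r₁, r₂, hT, hall, hsat⟩ := h
  obtain ⟨V, π, hπ, hk⟩ :=
    SemiAbelian.exists_quotient _ _ (Pt.isEquivalenceRelation_hom r₁ r₂ hT)
  obtain ⟨d, hd⟩ := IsRegularEpi.exists_of_isKernelPair π hk (P.orbit q).proj (by simp)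
  have hsec : Pt.Hom.hom (P.orbitSec q) ≫ π = (kernelPairPt q).proj ≫ (P.orbit q).sec ≫ π := by
    -- `c` sends `(a, a')` to `(a', a')`; both lie in the normal subobject, so `π` identifies their
    -- images.
    let c : kernelPairPt q ⟶ kernelPairPt q :=
      ⟨(kernelPairPt q).proj ≫ (kernelPairPt q).sec, by simp, by simp⟩
    obtain ⟨t, h₁, h₂⟩ := hall (𝟙 _) c
    have h₁' := congrArg Pt.Hom.hom h₁
    have h₂' := congrArg Pt.Hom.hom h₂
    simp only [Pt.comp_hom, Category.id_comp] at h₁' h₂'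
    rw [← h₁', Category.assoc, hk.w, reassoc_of% h₂']
    simp [c]
  let φ : P.obj ⟶ V := Pt.Hom.hom (P.toOrbit q) ≫ π
  have hφd : φ ≫ d = P.proj := by simp [φ, hd]
  have hφs : P.sec ≫ φ = (P.orbit q).sec ≫ π := by simp [φ]
  have : Mono φ := by
    refine SemiAbelian.mono_of_kernel φ fun S t ht => ?_
    have htp : t ≫ P.proj = 0 := by rw [← hφd, reassoc_of% ht, zero_comp]
    obtain ⟨l, h₁, h₂⟩ := hk.exists_lift 0 (t ≫ Pt.Hom.hom (P.toOrbit q))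
      (by rw [zero_comp, Category.assoc]; exact ht.symm)
    have hl : l ≫ T.proj = 0 := by rw [← Pt.Hom.hom_proj r₁, reassoc_of% h₁, zero_comp]
    -- `(t, 0)` is related to `0`, so saturation puts it in the kernel pair: `t = s a` for some `a`,
    -- and then `a = p t = 0`.
    obtain ⟨x, hx⟩ := hsat
      (Pt.freeDesc (0 : S ⟶ (kernelPairPt q).obj) (zero_comp : _ = (0 : S ⟶ A)))
      (Pt.freeDesc l hl) (Pt.freeHom_ext (by simp [h₁]))
    have hx' := congrArg (fun f => Pt.freeInl _ ≫ Pt.Hom.hom f) hx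
    simp only [Pt.comp_hom, Pt.freeInl_freeDesc_assoc, h₂] at hx'
    have hx'' := congrArg (· ≫ P.orbitFst q) hx'
    simp only [Category.assoc, Pt.orbitSec_fst, Pt.toOrbit_fst, Category.comp_id] at hx''
    have h0 := congrArg (· ≫ P.proj) hx''
    simp only [Category.assoc, htp, Pt.sec_proj, Category.comp_id] at h0
    rw [← hx'', reassoc_of% h0, zero_comp]
  have : Mono (pullback.snd φ π) := MorphismProperty.pullback_snd (P := .monomorphisms C) φ π this
  have : IsIso (pullback.snd φ π) := by
    -- The elements of the orbit whose class lies in `P` include the section and the kernel of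
    -- `P.orbitProj q`, so `π` factors through `φ`; the factor is `ρ`.
    refine SemiAbelian.isIso_of_mono (P.orbitSec_proj q) (pullback.snd φ π)
      (pullback.lift ((kernelPairPt q).proj ≫ P.sec) (Pt.Hom.hom (P.orbitSec q)) ?_)
      (pullback.lift_snd _ _ _) fun S t ht => ?_
    · rw [Category.assoc, hφs, hsec]
    · have := (P.orbitProj_kernel q t ht).2
      exact ⟨pullback.lift (t ≫ P.orbitFst q) t (by rw [← Category.assoc, this]),
        pullback.lift_snd _ _ _⟩
  have hρ : (inv (pullback.snd φ π) ≫ pullback.fst φ π) ≫ φ = π := by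
    rw [Category.assoc, pullback.condition, IsIso.inv_hom_id_assoc]
  refine ⟨inv (pullback.snd φ π) ≫ pullback.fst φ π, ?_, ?_, ?_⟩
  · rw [← hφd, ← Category.assoc, hρ, hd]
  · rw [← cancel_mono φ, Category.assoc, hρ, Category.id_comp]
  · rw [← cancel_mono φ, Category.assoc, hρ, Category.assoc, hφs, hsec]

variable {P : Pt A} {q : A ⟶ Q} {ρ : (P.orbit q).obj ⟶ P.obj}

/-- A transport morphism exhibits the orbit as an equivalence relation on the domain of `P`. -/
theorem Pt.isEquivalenceRelation_transport (h₁ : ρ ≫ P.proj = (P.orbit q).proj)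
    (h₂ : Pt.Hom.hom (P.toOrbit q) ≫ ρ = 𝟙 _)
    (h₃ : Pt.Hom.hom (P.orbitSec q) ≫ ρ = (kernelPairPt q).proj ≫ P.sec) :
    IsEquivalenceRelation (P.orbitFst q) ρ := by
  have hW := P.orbit_isPullback q
  have hR := kernelPairPt_isKernelPair q
  have hfst := P.orbitSec_fst q
  have hto := P.toOrbit_fst q
  -- Symmetry: `σ(x, a) = (ρ(x, a), p x)`.
  obtain ⟨σ, hσ₁, hσ₂⟩ := hW.exists_lift ρ (P.orbitFst q ≫ P.proj)
    (by rw [reassoc_of% h₁, Category.assoc]; exact hW.w.symm)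
  have hσ : σ ≫ ρ = P.orbitFst q := by
    obtain ⟨τ, hτ₁, hτ₂⟩ := hR.exists_lift _ _ hR.w.symm
    refine SemiAbelian.hom_ext_of_split (P.orbitSec_proj q) ?_ fun T t ht => ?_
    · have : Pt.Hom.hom (P.orbitSec q) ≫ σ = τ ≫ Pt.Hom.hom (P.orbitSec q) := by
        apply hW.hom_ext
        · rw [Category.assoc, hσ₁, h₃, Category.assoc, hfst, reassoc_of% hτ₁]
        · rw [Category.assoc, hσ₂, reassoc_of% hfst, P.sec_proj, Category.assoc,
            Pt.Hom.hom_proj, hτ₂, Category.comp_id]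
      rw [reassoc_of% this, h₃, reassoc_of% hτ₂, hfst]
    · obtain ⟨-, ht⟩ := P.orbitProj_kernel q t ht
      have : Pt.Hom.hom (P.toOrbit q) ≫ σ = Pt.Hom.hom (P.toOrbit q) := by
        apply hW.hom_ext
        · rw [Category.assoc, hσ₁, h₂, hto]
        · rw [Category.assoc, hσ₂, reassoc_of% hto, Pt.Hom.hom_proj]
      rw [← ht, Category.assoc, Category.assoc, reassoc_of% this, h₂,
        Category.assoc, Category.assoc, hto]
  let w := pullback.fst ρ (P.orbitFst q)
  let w' := pullback.snd ρ (P.orbitFst q)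
  have hw : w ≫ ρ = w' ≫ P.orbitFst q := pullback.condition
  -- Transitivity: `t` sends the composable pair `(x, a)`, `(ρ(x, a), b)` to `(x, b)`.
  obtain ⟨t, ht₁, ht₂⟩ := hW.exists_lift (w ≫ P.orbitFst q) (w' ≫ (P.orbit q).proj) (by
    rw [Category.assoc, Category.assoc, hW.w, ← hW.w, ← reassoc_of% hw, reassoc_of% h₁, hW.w])
  have ht : t ≫ ρ = w' ≫ ρ := by
    -- Composable pairs in the orbit are split over composable pairs in the kernel pair, so
    -- associativity of transport is checked on that section and kernel.
    let r := pullback.fst (kernelPairPt q).proj (kernelPairFst q)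
    let r' := pullback.snd (kernelPairPt q).proj (kernelPairFst q)
    have hr : r ≫ (kernelPairPt q).proj = r' ≫ kernelPairFst q := pullback.condition
    let p := pullback.lift (w ≫ P.orbitProj q) (w' ≫ P.orbitProj q)
      (show _ ≫ (kernelPairPt q).proj = _ ≫ kernelPairFst q by
        rw [Category.assoc, Category.assoc, P.orbitProj_fst, P.orbitProj_snd,
          ← h₁, reassoc_of% hw])
    let s := pullback.lift (r ≫ Pt.Hom.hom (P.orbitSec q)) (r' ≫ Pt.Hom.hom (P.orbitSec q))
      (show _ ≫ ρ = _ ≫ P.orbitFst q by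
        rw [Category.assoc, Category.assoc, h₃, hfst, reassoc_of% hr])
    have hp : p ≫ r = w ≫ P.orbitProj q := pullback.lift_fst _ _ _
    have hp' : p ≫ r' = w' ≫ P.orbitProj q := pullback.lift_snd _ _ _
    have hZw : s ≫ w = r ≫ Pt.Hom.hom (P.orbitSec q) := pullback.lift_fst _ _ _
    have hZw' : s ≫ w' = r' ≫ Pt.Hom.hom (P.orbitSec q) := pullback.lift_snd _ _ _
    have hsp : s ≫ p = 𝟙 _ := by
      apply pullback.hom_ext
      · change (s ≫ p) ≫ r = 𝟙 _ ≫ r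
        rw [Category.assoc, hp, reassoc_of% hZw, P.orbitSec_proj, Category.comp_id,
          Category.id_comp]
      · change (s ≫ p) ≫ r' = 𝟙 _ ≫ r'
        rw [Category.assoc, hp', reassoc_of% hZw', P.orbitSec_proj, Category.comp_id,
          Category.id_comp]
    refine SemiAbelian.hom_ext_of_split hsp ?_ fun T z hz => ?_
    · obtain ⟨p, hp₁, hp₂⟩ := hR.exists_lift (r ≫ kernelPairFst q) (r' ≫ (kernelPairPt q).proj) (by
        rw [Category.assoc, hR.w, reassoc_of% hr, Category.assoc, hR.w])
      have : s ≫ t = p ≫ Pt.Hom.hom (P.orbitSec q) := by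
        apply hW.hom_ext
        · rw [Category.assoc, ht₁, reassoc_of% hZw, hfst, Category.assoc, hfst, reassoc_of% hp₁]
        · rw [Category.assoc, ht₂, reassoc_of% hZw', Pt.Hom.hom_proj, Category.assoc,
            Pt.Hom.hom_proj, hp₂]
      rw [reassoc_of% this, h₃, reassoc_of% hp₂, reassoc_of% hZw', h₃]
    · have hz₁ : (z ≫ w) ≫ P.orbitProj q = 0 := by
        rw [Category.assoc, ← hp, reassoc_of% hz, zero_comp]
      have hz₂ : (z ≫ w') ≫ P.orbitProj q = 0 := by
        rw [Category.assoc, ← hp', reassoc_of% hz, zero_comp]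
      obtain ⟨-, hw₁⟩ := P.orbitProj_kernel q _ hz₁
      obtain ⟨hy, hw₂⟩ := P.orbitProj_kernel q _ hz₂
      have hyy : z ≫ w ≫ P.orbitFst q = z ≫ w' ≫ P.orbitFst q := by
        rw [← hw, ← Category.assoc z w ρ, ← hw₁, Category.assoc, h₂]; simp
      have : z ≫ t = z ≫ w' := by
        apply hW.hom_ext
        · rw [Category.assoc, ht₁, hyy, Category.assoc]
        · rw [Category.assoc, ht₂, Category.assoc]
      rw [reassoc_of% this]
  refine ⟨⟨{
    right_cancellation := ?_
    r := Pt.Hom.hom (P.toOrbit q)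
    s := σ
    c := _
    isLimit := pullback.isLimit ρ (P.orbitFst q)
    t := t
    reflexivity₁ := hto
    reflexivity₂ := h₂
    symmetry₁ := hσ₁
    symmetry₂ := hσ
    transitivity₁ := ht₁
    transitivity₂ := ht }⟩⟩
  intro S f g hfg hfg'
  refine hW.hom_ext hfg ?_
  rw [← h₁, reassoc_of% hfg']

/-- A point endowed with a transport morphism along the kernel pair of a regular epimorphism `q`
descends along `q`. -/
theorem Pt.exists_isCartesian_of_transport [IsRegularEpi q] (h₁ : ρ ≫ P.proj = (P.orbit q).proj)
    (h₂ : Pt.Hom.hom (P.toOrbit q) ≫ ρ = 𝟙 _)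
    (h₃ : Pt.Hom.hom (P.orbitSec q) ≫ ρ = (kernelPairPt q).proj ≫ P.sec) :
    ∃ (D : Pt Q) (γ : P.obj ⟶ D.obj), P.IsCartesian D γ q := by
  have hW := P.orbit_isPullback q
  obtain ⟨D, γ, hγ, hk⟩ :=
    SemiAbelian.exists_quotient _ _ (Pt.isEquivalenceRelation_transport h₁ h₂ h₃)
  obtain ⟨d, hd⟩ := IsRegularEpi.exists_of_isKernelPair γ hk (P.proj ≫ q)
    (by rw [reassoc_of% h₁]; exact hW.w)
  -- The section descends because `ρ` relates `s a` to `s a'`.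
  obtain ⟨s, hs⟩ := IsRegularEpi.exists_of_isKernelPair q (kernelPairPt_isKernelPair q)
    (P.sec ≫ γ) (by
      rw [← Category.assoc, ← P.orbitSec_fst, Category.assoc, hk.w, reassoc_of% h₃])
  have hsd : s ≫ d = 𝟙 Q := by
    rw [← cancel_epi q, reassoc_of% hs, hd, P.sec_proj_assoc, Category.comp_id]
  refine ⟨⟨D, d, s, hsd⟩, γ, hs.symm, ?_⟩
  let f : P.obj ⟶ pullback d q := pullback.lift γ P.proj hd
  have hf₁ : f ≫ pullback.fst d q = γ := pullback.lift_fst _ _ _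
  have hf₂ : f ≫ pullback.snd d q = P.proj := pullback.lift_snd _ _ _
  have : Mono f := by
    refine ⟨fun {S} a b hab => ?_⟩
    have e₁ : a ≫ γ = b ≫ γ := by rw [← hf₁, reassoc_of% hab]
    have e₂ : a ≫ P.proj = b ≫ P.proj := by rw [← hf₂, reassoc_of% hab]
    obtain ⟨l, hl₁, hl₂⟩ := hk.exists_lift a b e₁
    -- Related elements in the same fibre are equal: the transport between them is trivial.
    have : l = a ≫ Pt.Hom.hom (P.toOrbit q) := by
      apply hW.hom_ext
      · rw [hl₁, Category.assoc, P.toOrbit_fst, Category.comp_id]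
      · rw [← h₁, reassoc_of% hl₂, h₁, Category.assoc, Pt.Hom.hom_proj, e₂]
    rw [← hl₂, this, Category.assoc, h₂, Category.comp_id]
  have hρf₁ : (ρ ≫ f) ≫ pullback.fst d q = P.orbitFst q ≫ γ := by
    rw [Category.assoc, hf₁, hk.w]
  have hρf₂ : (ρ ≫ f) ≫ pullback.snd d q = (P.orbit q).proj := by
    rw [Category.assoc, hf₂, h₁]
  -- By pasting, `ρ ≫ f` is a base change of the regular epimorphism `γ`; this makes `f` a strong
  -- epimorphism.
  have hsq : IsPullback (ρ ≫ f) (P.orbitFst q) (pullback.fst d q) γ :=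
    IsPullback.of_right (by rw [hρf₂, hd]; exact hW.flip) hρf₁
      (IsPullback.of_hasPullback d q).flip
  have : IsRegularEpi (ρ ≫ f) :=
    Regular.regularEpiIsStableUnderBaseChange.of_isPullback hsq.flip hγ
  have : StrongEpi f := strongEpi_of_strongEpi ρ f
  have : IsIso f := isIso_of_mono_of_strongEpi f
  exact IsPullback.of_iso_pullback ⟨hd⟩ (asIso f) hf₁ hf₂

end Transport

/-! ### Normality of the kernel pair in the orbit -/

section Normality

variable {C : Type u} [Category.{v} C] [HasZeroMorphisms C] [StronglySemiAbelian C] {A Q : C}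

/-- If the restriction of `P` to the kernel of `q` is a product, the kernel pair of `q` is normal in
the orbit of `P`. -/
theorem Pt.isNormalMonomorphism_orbitSec (P : Pt A) (q : A ⟶ Q) {K : C} (k : K ⟶ A)
    (wk : k ≫ q = 0) (hk : IsLimit (KernelFork.ofι k wk)) {Y : C}
    (e : P.pull k ≅ productPt Y K) : IsNormalMonomorphism (P.orbitSec q) := by
  let O : C := (HasZeroObject.zero' C).zero
  have hO {X : C} (f g : X ⟶ O) : f = g := HasZeroObject.to_zero_ext _ _
  have hO' {X : C} (f g : O ⟶ X) : f = g := HasZeroObject.from_zero_ext _ _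
  apply (StronglySemiAbelian.changeOfBase_normal (0 : O ⟶ A)).reflects_normal
  let ι (X : Pt A) : (X.pull (0 : O ⟶ A)).obj ⟶ X.obj := X.pullFst 0
  have hpb (X : Pt A) := (X.pull_isCartesian (0 : O ⟶ A)).isPullback
  have hι (X : Pt A) : ι X ≫ X.proj = 0 := (hpb X).w.trans comp_zero
  have hιext (X : Pt A) {T : C} {a b : T ⟶ (X.pull (0 : O ⟶ A)).obj} (h : a ≫ ι X = b ≫ ι X) :
      a = b := (hpb X).hom_ext h (hO _ _)
  have hιlift (X : Pt A) {T : C} (a : T ⟶ X.obj) (h : a ≫ X.proj = 0) :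
      ∃ l : T ⟶ (X.pull (0 : O ⟶ A)).obj, l ≫ ι X = a := by
    obtain ⟨l, hl, -⟩ := (hpb X).exists_lift a 0 (by rw [h, comp_zero])
    exact ⟨l, hl⟩
  let J : (kernelPairPt q).pull (0 : O ⟶ A) ⟶ (P.orbit q).pull (0 : O ⟶ A) :=
    Pt.Hom.pull 0 (P.orbitSec q)
  have hJ : Pt.Hom.hom J ≫ ι (P.orbit q) = ι (kernelPairPt q) ≫ Pt.Hom.hom (P.orbitSec q) :=
    Pt.Hom.pull_hom_fst 0 (P.orbitSec q)
  change IsNormalMonomorphism J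
  have hW := P.orbit_isPullback q
  have hPk := (P.pull_isCartesian k).isPullback
  have hPs := (P.pull_isCartesian k).sec_comm
  obtain ⟨κ, hκ⟩ : ∃ κ : ((P.orbit q).pull (0 : O ⟶ A)).obj ⟶ K,
      κ ≫ k = ι (P.orbit q) ≫ P.orbitFst q ≫ P.proj :=
    ⟨_, (KernelFork.IsLimit.lift' hk _
      (by rw [Category.assoc, Category.assoc, hW.w, reassoc_of% hι (P.orbit q), zero_comp])).2⟩
  -- `m` sends `(x, 0)`, where `q (p x) = 0`, to `x` in the restriction of `P` to `K`.
  obtain ⟨m, hm₁, hm₂⟩ := hPk.exists_lift (ι (P.orbit q) ≫ P.orbitFst q) κ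
    (by rw [Category.assoc]; exact hκ.symm)
  obtain ⟨E, hE, hEs, hEp⟩ : ∃ E : (P.pull k).obj ⟶ Y ⨯ K,
      IsIso E ∧ (P.pull k).sec ≫ E = prod.lift 0 (𝟙 K) ∧ E ≫ prod.snd = (P.pull k).proj :=
    ⟨Pt.Hom.hom e.hom, inferInstanceAs (IsIso ((Pt.domain K).map e.hom)), Pt.Hom.sec_hom e.hom,
      Pt.Hom.hom_proj e.hom⟩
  have hprod : (P.pull k).sec ≫ E ≫ prod.fst = 0 := by
    rw [reassoc_of% hEs, prod.lift_fst]
  let Z : Pt O := ⟨Y, 0, 0, hO _ _⟩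
  -- `g` is the `Y`-coordinate; `J` is its fibre over zero.
  let g : (P.orbit q).pull (0 : O ⟶ A) ⟶ Z :=
    ⟨m ≫ E ≫ prod.fst, hO _ _, hO' _ _⟩
  have hJm : Pt.Hom.hom J ≫ m = Pt.Hom.hom J ≫ κ ≫ (P.pull k).sec := by
    apply hPk.hom_ext
    · rw [Category.assoc, hm₁, Category.assoc, Category.assoc, hPs, reassoc_of% hκ,
        reassoc_of% hJ, reassoc_of% hJ, P.orbitSec_fst, reassoc_of% P.orbitSec_fst q,
        P.sec_proj_assoc]
    · rw [Category.assoc, Category.assoc, Category.assoc, hm₂, Pt.sec_proj, Category.comp_id]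
  have hJg : Pt.Hom.hom (J ≫ g) = 0 := by
    change Pt.Hom.hom J ≫ m ≫ E ≫ prod.fst = 0
    rw [reassoc_of% hJm, hprod, comp_zero, comp_zero]
  have : Mono (Pt.Hom.hom J) := ⟨fun {T} a b hab => hιext _ <| by
    rw [← cancel_mono (Pt.Hom.hom (P.orbitSec q)), Category.assoc, Category.assoc, ← hJ,
      reassoc_of% hab]⟩
  refine isNormalMonomorphism_of_fibre J (Pt.mono_of_mono_hom J) g (fun T x x' => ?_)
    fun T x t h => ?_
  · apply Pt.hom_ext
    exact (Pt.comp_hom x (J ≫ g)).trans ((by rw [hJg, comp_zero, comp_zero] :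
      Pt.Hom.hom x ≫ Pt.Hom.hom (J ≫ g) = Pt.Hom.hom x' ≫ Pt.Hom.hom (J ≫ g)))
  · have ht : Pt.Hom.hom t ≫ m ≫ E ≫ prod.fst = 0 :=
      (congrArg Pt.Hom.hom h).trans (by rw [Pt.comp_hom, hJg, comp_zero])
    have hte : Pt.Hom.hom t ≫ m = Pt.Hom.hom t ≫ κ ≫ (P.pull k).sec := by
      rw [← cancel_mono E]
      apply prod.hom_ext
      · simp only [Category.assoc]
        rw [ht, hprod, comp_zero, comp_zero]
      · simp only [Category.assoc]
        rw [hEp, hm₂, Pt.sec_proj, Category.comp_id]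
    have hx : Pt.Hom.hom t ≫ ι (P.orbit q) ≫ P.orbitFst q = Pt.Hom.hom t ≫ κ ≫ k ≫ P.sec := by
      rw [← hm₁, reassoc_of% hte, hPs]
    -- A zero `Y`-coordinate forces `x = s a` with `a` in `K`, so `(x, 0)` is the image of `(a, 0)`.
    obtain ⟨r, hr₁, hr₂⟩ := (kernelPairPt_isKernelPair q).exists_lift
      (Pt.Hom.hom t ≫ κ ≫ k) 0 (by simp [wk])
    obtain ⟨l, hl⟩ := hιlift (kernelPairPt q) r hr₂
    refine ⟨⟨l, hO _ _, hO' _ _⟩, Pt.hom_ext ?_⟩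
    change l ≫ Pt.Hom.hom J = _
    apply hιext
    rw [Category.assoc, hJ, reassoc_of% hl]
    apply hW.hom_ext
    · rw [Category.assoc, Category.assoc, hx, P.orbitSec_fst, reassoc_of% hr₁]
    · rw [Category.assoc, Category.assoc, hι, Pt.Hom.hom_proj, hr₂, comp_zero]

end Normality

/-! ### The converse: descended points restrict to products -/

/-- The restriction to a kernel of `q` of a point which descends along `q` is a product. -/
theorem Pt.IsCartesian.nonempty_pull_iso {C : Type u} [Category.{v} C] [HasZeroMorphisms C]
    [HasPullbacks C] [HasBinaryProducts C] {A Q : C} {P : Pt A} {D : Pt Q}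
    {γ : P.obj ⟶ D.obj} {q : A ⟶ Q} (h : P.IsCartesian D γ q)
    {K : C} (k : K ⟶ A) (wk : k ≫ q = 0)
    {Y : C} (kc : Y ⟶ P.obj) (wkc : kc ≫ P.proj = 0) (hkc : IsLimit (KernelFork.ofι kc wkc)) :
    Nonempty (P.pull k ≅ productPt Y K) := by
  have hP := h.isPullback
  have hPk := (P.pull_isCartesian k).isPullback
  have hPs := (P.pull_isCartesian k).sec_comm
  -- `x` moves an element of `Y` to the fibre over a given element of `K`, keeping its image under
  -- `γ`; `z` below moves it back to the fibre over zero.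
  obtain ⟨x, hx₁, hx₂⟩ := hP.exists_lift (prod.fst ≫ kc ≫ γ) ((prod.snd : Y ⨯ K ⟶ K) ≫ k)
    (by simp [hP.w, wk, reassoc_of% wkc])
  obtain ⟨f, hf₁, hf₂⟩ := hPk.exists_lift x prod.snd hx₂
  obtain ⟨z, hz₁, hz₂⟩ := hP.exists_lift (P.pullFst k ≫ γ) 0
    (by rw [Category.assoc, hP.w, reassoc_of% hPk.w, wk, comp_zero, zero_comp])
  obtain ⟨y, hy⟩ : ∃ y : (P.pull k).obj ⟶ Y, y ≫ kc = z :=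
    ⟨_, (KernelFork.IsLimit.lift' hkc z hz₂).2⟩
  have : Mono kc := Fork.IsLimit.mono hkc
  have hys : (P.pull k).sec ≫ y = 0 := by
    rw [← cancel_mono kc, Category.assoc, hy, zero_comp]
    apply hP.hom_ext
    · rw [Category.assoc, hz₁, reassoc_of% hPs, h.sec_comm, reassoc_of% wk, zero_comp, zero_comp]
    · rw [Category.assoc, hz₂, comp_zero, zero_comp]
  refine ⟨⟨⟨prod.lift y (P.pull k).proj, prod.lift_snd _ _, ?_⟩, ⟨f, hf₂, ?_⟩, ?_, ?_⟩⟩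
  · change (P.pull k).sec ≫ prod.lift y (P.pull k).proj = prod.lift 0 (𝟙 K)
    rw [prod.comp_lift, hys, Pt.sec_proj]
  · change prod.lift 0 (𝟙 K) ≫ f = _
    apply hPk.hom_ext
    · rw [Category.assoc, hf₁, hPs]
      apply hP.hom_ext
      · rw [Category.assoc, hx₁, prod.lift_fst_assoc, zero_comp, Category.assoc, h.sec_comm,
          reassoc_of% wk, zero_comp]
      · rw [Category.assoc, hx₂, prod.lift_snd_assoc, Category.id_comp, Category.assoc, P.sec_proj,
          Category.comp_id]
    · rw [Category.assoc, hf₂, prod.lift_snd, Pt.sec_proj]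
  · apply Pt.hom_ext
    change prod.lift y (P.pull k).proj ≫ f = 𝟙 (P.pull k).obj
    apply hPk.hom_ext
    · rw [Category.assoc, hf₁, Category.id_comp]
      apply hP.hom_ext
      · rw [Category.assoc, hx₁, prod.lift_fst_assoc, reassoc_of% hy, hz₁]
      · rw [Category.assoc, hx₂, prod.lift_snd_assoc, hPk.w]
    · rw [Category.assoc, hf₂, prod.lift_snd, Category.id_comp]
  · apply Pt.hom_ext
    change f ≫ prod.lift y (P.pull k).proj = 𝟙 (Y ⨯ K)
    apply prod.hom_ext
    · rw [Category.assoc, prod.lift_fst, Category.id_comp, ← cancel_mono kc, Category.assoc, hy]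
      apply hP.hom_ext
      · rw [Category.assoc, hz₁, reassoc_of% hf₁, hx₁, Category.assoc]
      · rw [Category.assoc, hz₂, comp_zero, Category.assoc, wkc, comp_zero]
    · rw [Category.assoc, prod.lift_snd, hf₂, Category.id_comp]

end StrongSemiAb

open StrongSemiAb

theorem proposition4p1 {C : Type u} [Category.{v} C] [HasZeroMorphisms C] [StronglySemiAbelian C]
    {A Q : C} (P : Pt A) (q : A ⟶ Q) (hq : IsRegularEpi q)
    {K : C} (k : K ⟶ A) (wk : k ≫ q = 0) (hk : IsLimit (KernelFork.ofι k wk))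
    {Y : C} (kc : Y ⟶ P.obj) (wkc : kc ≫ P.proj = 0) (hkc : IsLimit (KernelFork.ofι kc wkc)) :
    Nonempty ((changeOfBase k).obj P ≅ productPt Y K) ↔
      ∃ (D : Pt Q) (γ : P.obj ⟶ D.obj), P.IsCartesian D γ q := by
  refine ⟨fun ⟨e⟩ => ?_, fun ⟨D, γ, h⟩ => h.nonempty_pull_iso k wk kc wkc hkc⟩
  obtain ⟨ρ, h₁, h₂, h₃⟩ := P.exists_transport q (P.isNormalMonomorphism_orbitSec q k wk hk e)
  exact Pt.exists_isCartesian_of_transport h₁ h₂ h₃
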